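/- Let $M$ be a closed smooth 3-manifold with an oriented contact structure $\xi$, and let $(J,\theta)$ be an oriented pseudohermitian structure compatible with $\xi$: $\theta$ is a global smooth contact form with $\ker\theta=\xi$ and $d\theta(u,v)>0$ for every oriented basis $(u,v)$ of $\xi$, and $J:\xi\to\xi$ is a smooth endomorphism with $J^2=-1$ such that $(v,Jv)$ is an oriented basis of $\xi$ for every $0\ne v\in\xi$. Let $T$ be the characteristic vector field ($\theta(T)=1$, $d\theta(T,\cdot)=0$) and $h(u,v)=\frac12 d\theta(u,Jv)$ on $\xi$. For a local $h$-unit section $e_1$ of $\xi$ put $e_2=Je_1$, let $(\theta,e^1,e^2)$ be the coframe dual to $(T,e_1,e_2)$, and put $\theta^1=e^1+ie^2$, $\theta^{\bar 1}=e^1-ie^2$, $Z_1=\frac12(e_1-ie_2)$, $Z_{\bar 1}=\frac12(e_1+ie_2)$. The connection form $\omega_1{}^1=i\omega$ ($\omega$ a real 1-form) of the pseudohermitian connection is determined by $d\theta^1=\theta^1\wedge\omega_1{}^1+A\,\theta\wedge\theta^{\bar 1}$ with a complex function $A$, and the Tanaka–Webster curvature $\mathcal W$ is the real function on $M$ with $d\omega(e_1,e_2)=-2\mathcal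 W$. For a smooth real 1-form $a$ on $M$, a smooth function $\alpha:M\to\mathbb C$ and a smooth section $\beta=\beta_{\bar 1}\frac{1}{\sqrt2}\theta^{\bar 1}$ of $\Lambda^{0,1}\xi^*$, put, for a complex tangent vector $v$, $\nabla^a_v\alpha=v(\alpha)+i\,a(v)\alpha$ and $\nabla^a_v\beta_{\bar 1}=v(\beta_{\bar 1})+i(\omega+a)(v)\beta_{\bar 1}$, and write $\alpha^a_{,\bar 1}=\nabla^a_{Z_{\bar 1}}\alpha$, $\beta^a_{\bar 1,1}=\nabla^a_{Z_1}\beta_{\bar 1}$, $\alpha^a_{,0}=\nabla^a_T\alpha$, $\beta^a_{\bar 1,0}=\nabla^a_T\beta_{\bar 1}$. Consider the monopole equations $$\alpha^a_{,\bar 1}=0,\qquad \beta^a_{\bar 1,1}=0,\qquad da(e_1,e_2)-\mathcal W=|\alpha|^2-|\beta_{\bar 1}|^2. \qquad (\ast)$$ (These equations do not depend on the choice of the local frame $e_1$.) **Theorem B.** If $\mathcal W>0$ on $M$, then there is no solution $(a,\alpha,\beta)$ of $(\ast)$ that satisfies $\alpha^a_{,0}=0$ and $\beta^a_{\bar 1,0}=0$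 and for which $\alpha$ and $\beta$ are not both identically zero. -/

import Mathlib

open scoped Manifold ContDiff

noncomputable section

namespace ContactMonopole

/-- The model space of a 3-manifold without boundary. -/
abbrev E3 : Type := EuclideanSpace ℝ (Fin 3)

/-- The tangent space of the 3-manifold `M` at `x`. -/
abbrev Tan {M : Type*} [TopologicalSpace M] [ChartedSpace E3 M] (x : M) : Type :=
  TangentSpace (𝓡 3) x

/-- Vector fields on `M` (no regularity). -/
abbrev VField (M : Type*) [TopologicalSpace M] [ChartedSpace E3 M] : Type _ :=
  (x : M) → Tan x

/-- Real 1-forms on `M` (no regularity). -/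
abbrev OneForm (M : Type*) [TopologicalSpace M] [ChartedSpace E3 M] : Type _ :=
  (x : M) → (Tan x →L[ℝ] ℝ)

section Calculus

variable {M : Type*} [TopologicalSpace M] [ChartedSpace E3 M] [IsManifold (𝓡 3) ∞ M]

/-- The vector field `X` is `C^∞` on the set `U` (used for open `U`). -/
def SmoothFieldOn (X : VField M) (U : Set M) : Prop :=
  ContMDiffOn (𝓡 3) (𝓡 3).tangent ∞ (fun x => (⟨x, X x⟩ : TangentBundle (𝓡 3) M)) U

/-- The 1-form `η` is `C^∞` on the set `U` (used for open `U`). -/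
def SmoothFormOn (η : OneForm M) (U : Set M) : Prop :=
  ContMDiffOn (𝓡 3) ((𝓡 3).prod 𝓘(ℝ, E3 →L[ℝ] ℝ)) ∞
    (fun x => Bundle.TotalSpace.mk' (E3 →L[ℝ] ℝ)
      (E := fun x : M => (TangentSpace (𝓡 3) x →L[ℝ] Bundle.Trivial M ℝ x)) x (η x)) U

/-- The 1-form `η` read in the chart at `x`: its pullback under the inverse of that chart. -/
def chartForm (η : OneForm M) (x : M) (y : E3) : E3 →L[ℝ] ℝ :=
  (η ((extChartAt (𝓡 3) x).symm y)).comp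
    (mfderiv 𝓘(ℝ, E3) (𝓡 3) (extChartAt (𝓡 3) x).symm y)

/-- The exterior derivative `dη` of a 1-form at `x`, evaluated on `u`, `v`, computed in the chart
at `x`.  The normalization is `dη(X,Y) = X(η(Y)) - Y(η(X)) - η([X,Y])`. -/
def extD (η : OneForm M) (x : M) (u v : Tan x) : ℝ :=
  let u' : E3 := mfderiv (𝓡 3) 𝓘(ℝ, E3) (extChartAt (𝓡 3) x) x u
  let v' : E3 := mfderiv (𝓡 3) 𝓘(ℝ, E3) (extChartAt (𝓡 3) x) x v
  let p : E3 := extChartAt (𝓡 3) x x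
  fderiv ℝ (chartForm η x) p u' v' - fderiv ℝ (chartForm η x) p v' u'

/-- The derivative `v(f)` of a complex function along the tangent vector `v`. -/
def dirDeriv (f : M → ℂ) (x : M) (v : Tan x) : ℂ :=
  mfderiv (𝓡 3) 𝓘(ℝ, ℂ) f x v

/-- `(∇_v f)(x) = v(f) + i A(v) f(x)`: the covariant derivative, along the tangent vector `v`, of
the component `f` of a section of a Hermitian line bundle in a unitary frame in which the
connection is `d + i A`, `A` a real 1-form. -/
def covD (A : OneForm M) (f : M → ℂ) (x : M) (v : Tan x) : ℂ :=
  dirDeriv f x v + Complex.I * (A x v : ℂ) * f x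

end Calculus

/-- An oriented contact structure on the 3-manifold `M`: an oriented smooth plane field `ξ` which
is locally the kernel of a smooth 1-form `η` with `η ∧ dη ≠ 0` everywhere. -/
structure OrientedContactStructure (M : Type*) [TopologicalSpace M] [ChartedSpace E3 M]
    [IsManifold (𝓡 3) ∞ M] where
  /-- the contact plane `ξ_x` -/
  plane : (x : M) → Submodule ℝ (Tan x)
  /-- the orientation of `ξ_x` -/
  orient : (x : M) → Orientation ℝ (plane x) (Fin 2)
  /-- near every point `ξ` has a smooth, positively oriented frame -/
  oriented_frame : ∀ x₀ : M, ∃ U : Set M, IsOpen U ∧ x₀ ∈ U ∧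
    ∃ X Y : (x : M) → plane x,
      SmoothFieldOn (fun x => (X x : Tan x)) U ∧ SmoothFieldOn (fun x => (Y x : Tan x)) U ∧
      ∀ x ∈ U, ∃ b : Module.Basis (Fin 2) ℝ (plane x),
        b 0 = X x ∧ b 1 = Y x ∧ b.orientation = orient x
  /-- near every point `ξ` is the kernel of a contact form `η`; the expression that is required not
  to vanish is `(η ∧ dη)(u, v, w)` -/
  contact : ∀ x₀ : M, ∃ U : Set M, IsOpen U ∧ x₀ ∈ U ∧ ∃ η : OneForm M, SmoothFormOn η U ∧
    ∀ x ∈ U, (∀ v : Tan x, v ∈ plane x ↔ η x v = 0) ∧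
      ∃ u v w : Tan x,
        η x u * extD η x v w + η x v * extD η x w u + η x w * extD η x u v ≠ 0

section Structures

variable {M : Type*} [TopologicalSpace M] [ChartedSpace E3 M] [IsManifold (𝓡 3) ∞ M]

/-- `(u, v)` is a positively oriented basis of the contact plane at `x`. -/
def OrientedContactStructure.IsPositivePair (ξ : OrientedContactStructure M) (x : M)
    (u v : ξ.plane x) : Prop :=
  ∃ b : Module.Basis (Fin 2) ℝ (ξ.plane x), b 0 = u ∧ b 1 = v ∧ b.orientation = ξ.orient x

/-- An oriented pseudohermitian structure `(J, θ)` compatible with the oriented contact structure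
`ξ`: a global smooth contact form `θ` with kernel `ξ` such that `dθ(u,v) > 0` for every oriented
basis `(u,v)` of `ξ`, and a smooth endomorphism `J` of `ξ` with `J² = -1` such that `(v, Jv)` is an
oriented basis of `ξ` for every nonzero `v` in `ξ`. -/
structure OrientedPseudohermitian (ξ : OrientedContactStructure M) where
  /-- the contact form -/
  θ : OneForm M
  θ_smooth : SmoothFormOn θ Set.univ
  mem_plane_iff : ∀ (x : M) (v : Tan x), v ∈ ξ.plane x ↔ θ x v = 0
  θ_oriented : ∀ (x : M) (u v : ξ.plane x), ξ.IsPositivePair x u v →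
    0 < extD θ x (u : Tan x) (v : Tan x)
  /-- the complex structure on the contact planes -/
  J : (x : M) → ξ.plane x →ₗ[ℝ] ξ.plane x
  /-- `J` is smooth: it maps smooth local sections of `ξ` to smooth local sections -/
  J_smooth : ∀ (U : Set M), IsOpen U → ∀ X : (x : M) → ξ.plane x,
    SmoothFieldOn (fun x => (X x : Tan x)) U → SmoothFieldOn (fun x => (J x (X x) : Tan x)) U
  J_sq : ∀ (x : M) (v : ξ.plane x), J x (J x v) = -v
  J_oriented : ∀ (x : M) (v : ξ.plane x), v ≠ 0 → ξ.IsPositivePair x v (J x v)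

variable {ξ : OrientedContactStructure M}

/-- The metric `h(u,v) = (1/2) dθ(u, Jv)` on the contact planes. -/
def OrientedPseudohermitian.h (P : OrientedPseudohermitian ξ) (x : M) (u v : ξ.plane x) : ℝ :=
  (1 / 2) * extD P.θ x (u : Tan x) (P.J x v : Tan x)

/-- A smooth form `β` of type `(0,1)` on the contact planes (a section of `Λ^{0,1} ξ^*`): at each
point a real linear map `ξ_x → ℂ` with `β(Jv) = -i β(v)`. -/
structure ZeroOneForm (P : OrientedPseudohermitian ξ) where
  /-- the form -/
  form : (x : M) → ξ.plane x →ₗ[ℝ] ℂ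
  type_zero_one : ∀ (x : M) (v : ξ.plane x), form x (P.J x v) = -Complex.I * form x v
  smooth : ∀ (U : Set M), IsOpen U → ∀ X : (x : M) → ξ.plane x,
    SmoothFieldOn (fun x => (X x : Tan x)) U →
      ContMDiffOn (𝓡 3) 𝓘(ℝ, ℂ) ∞ (fun x => form x (X x)) U

/-- A local unitary frame of the pseudohermitian structure `(J, θ)` on an open set `U`, together
with its dual coframe, its connection form and its torsion coefficient.  In complex terms
`Z₁ = (e₁ - i e₂)/2`, `θ¹ = e¹ + i e²`, `(θ, θ¹, θ^{1̄})` is dual to `(T, Z₁, Z_{1̄})`,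
`dθ = i θ¹ ∧ θ^{1̄}`, and the connection form `ω₁¹ = i ω` of the pseudohermitian connection
(`∇Z₁ = i ω ⊗ Z₁`) is the purely imaginary 1-form with
`dθ¹ = θ¹ ∧ ω₁¹ + A θ ∧ θ^{1̄}`; it is unique for a given frame.
All fields are only used, and only restricted, on `U`. -/
structure UnitaryFrame (P : OrientedPseudohermitian ξ) where
  /-- the domain of the frame -/
  U : Set M
  isOpen : IsOpen U
  /-- the characteristic (Reeb) vector field `T` of `θ` -/
  T : VField M
  T_smooth : SmoothFieldOn T U
  θ_T : ∀ x ∈ U, P.θ x (T x) = 1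
  dθ_T : ∀ x ∈ U, ∀ v : Tan x, extD P.θ x (T x) v = 0
  /-- the unit section `e₁` of `ξ` -/
  e₁ : (x : M) → ξ.plane x
  e₁_smooth : SmoothFieldOn (fun x => (e₁ x : Tan x)) U
  e₁_unit : ∀ x ∈ U, P.h x (e₁ x) (e₁ x) = 1
  /-- the section `e₂ = J e₁` of `ξ` -/
  e₂ : (x : M) → ξ.plane x
  e₂_eq : ∀ x ∈ U, e₂ x = P.J x (e₁ x)
  /-- the dual coframe `(θ, e¹, e²)` of `(T, e₁, e₂)` -/
  ε₁ : OneForm M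
  ε₂ : OneForm M
  ε₁_smooth : SmoothFormOn ε₁ U
  ε₂_smooth : SmoothFormOn ε₂ U
  ε₁_dual : ∀ x ∈ U, ε₁ x (T x) = 0 ∧ ε₁ x (e₁ x : Tan x) = 1 ∧ ε₁ x (e₂ x : Tan x) = 0
  ε₂_dual : ∀ x ∈ U, ε₂ x (T x) = 0 ∧ ε₂ x (e₁ x : Tan x) = 0 ∧ ε₂ x (e₂ x : Tan x) = 1
  /-- the real form `ω` of the connection form `ω₁¹ = i ω` -/
  conn : OneForm M
  conn_smooth : SmoothFormOn conn U
  /-- the torsion coefficient -/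
  A : M → ℂ
  /-- the structure equation `dθ¹ = θ¹ ∧ (i ω) + A θ ∧ θ^{1̄}`, evaluated on `(u, v)` -/
  structure_eq : ∀ x ∈ U, ∀ u v : Tan x,
    (extD ε₁ x u v : ℂ) + Complex.I * (extD ε₂ x u v : ℂ) =
      (((ε₁ x u : ℂ) + Complex.I * (ε₂ x u : ℂ)) * (Complex.I * (conn x v : ℂ))
        - ((ε₁ x v : ℂ) + Complex.I * (ε₂ x v : ℂ)) * (Complex.I * (conn x u : ℂ)))
      + A x * ((P.θ x u : ℂ) * ((ε₁ x v : ℂ) - Complex.I * (ε₂ x v : ℂ))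
        - (P.θ x v : ℂ) * ((ε₁ x u : ℂ) - Complex.I * (ε₂ x u : ℂ)))

namespace UnitaryFrame

variable {P : OrientedPseudohermitian ξ} (F : UnitaryFrame P)

/-- The Tanaka–Webster curvature `W`: `d(ω₁¹) ≡ W θ¹ ∧ θ^{1̄}` modulo `θ`, that is
`dω(e₁, e₂) = -2 W`.  Its value does not depend on the unitary frame. -/
def webster (x : M) : ℝ :=
  -(1 / 2) * extD F.conn x (F.e₁ x : Tan x) (F.e₂ x : Tan x)

/-- The component `β_{1̄}` of `β = β_{1̄} θ^{1̄}/√2`; since `θ^{1̄}(e₁) = 1`, it is `√2 β(e₁)`. -/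
def comp (β : ZeroOneForm P) (x : M) : ℂ :=
  (Real.sqrt 2 : ℂ) * β.form x (F.e₁ x)

/-- The connection `∇_can + i a` acts on the component `β_{1̄}` (with respect to `θ^{1̄}/√2`, for
which `∇_can θ^{1̄} = i ω ⊗ θ^{1̄}`) as `d + i (ω + a)`. -/
def twist (a : OneForm M) : OneForm M := fun x => F.conn x + a x

/-- `α^a_{,1̄} = (∇_{e₁} α + i ∇_{e₂} α)/2`, the covariant derivative along `Z_{1̄}`. -/
def alphaBar (a : OneForm M) (α : M → ℂ) (x : M) : ℂ :=
  (1 / 2) * (covD a α x (F.e₁ x : Tan x) + Complex.I * covD a α x (F.e₂ x : Tan x))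

/-- `β^a_{1̄,1} = (∇_{e₁} β - i ∇_{e₂} β)/2`, the covariant derivative along `Z₁`. -/
def betaOne (a : OneForm M) (β : ZeroOneForm P) (x : M) : ℂ :=
  (1 / 2) * (covD (F.twist a) (F.comp β) x (F.e₁ x : Tan x)
    - Complex.I * covD (F.twist a) (F.comp β) x (F.e₂ x : Tan x))

/-- `α^a_{,0}`, the covariant derivative along `T`. -/
def alphaZero (a : OneForm M) (α : M → ℂ) (x : M) : ℂ :=
  covD a α x (F.T x)

/-- `β^a_{1̄,0}`, the covariant derivative along `T`. -/
def betaZero (a : OneForm M) (β : ZeroOneForm P) (x : M) : ℂ :=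
  covD (F.twist a) (F.comp β) x (F.T x)

/-- The monopole equations for `(a, α, β)` at the point `x`, written in the frame. -/
def MonopoleEqAt (a : OneForm M) (α : M → ℂ) (β : ZeroOneForm P) (x : M) : Prop :=
  F.alphaBar a α x = 0 ∧ F.betaOne a β x = 0 ∧
    extD a x (F.e₁ x : Tan x) (F.e₂ x : Tan x) - F.webster x =
      ‖α x‖ ^ 2 - ‖F.comp β x‖ ^ 2

/-- The conditions `α^a_{,0} = 0`, `β^a_{1̄,0} = 0` at the point `x`, written in the frame. -/
def ReebParallelAt (a : OneForm M) (α : M → ℂ) (β : ZeroOneForm P) (x : M) : Prop :=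
  F.alphaZero a α x = 0 ∧ F.betaZero a β x = 0

end UnitaryFrame

namespace OrientedPseudohermitian

variable (P : OrientedPseudohermitian ξ)

/-- The Tanaka–Webster curvature is positive on all of `M`. -/
def PositiveWebster : Prop :=
  ∀ F : UnitaryFrame P, ∀ x ∈ F.U, 0 < F.webster x

/-- `(a, α, β)` is a smooth solution of the monopole equations with `α^a_{,0} = 0` and
`β^a_{1̄,0} = 0`.  These conditions do not depend on the unitary frame, so they are required in
some unitary frame about each point. -/
structure IsReebParallelMonopole (a : OneForm M) (α : M → ℂ) (β : ZeroOneForm P) : Prop where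
  a_smooth : SmoothFormOn a Set.univ
  α_smooth : ContMDiff (𝓡 3) 𝓘(ℝ, ℂ) ∞ α
  equations : ∀ x₀ : M, ∃ F : UnitaryFrame P, x₀ ∈ F.U ∧
    ∀ x ∈ F.U, F.MonopoleEqAt a α β x ∧ F.ReebParallelAt a α β x

/-- The solution is trivial: `α` and `β` vanish identically. -/
def IsTrivial (α : M → ℂ) (β : ZeroOneForm P) : Prop :=
  (∀ x, α x = 0) ∧ ∀ x, β.form x = 0

end OrientedPseudohermitian

end Structures

end ContactMonopole

end

noncomputable section

/-! The proof is a Bochner argument combined with the maximum principle for `u = |α|² + |β_{1̄}|²`.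
Suppose a section `f` satisfies `∇_X f + i ∇_Y f = 0`. Applying `∇_X - i ∇_Y` to this equation gives
`∇_X² f + ∇_Y² f + i [∇_X, ∇_Y] f = 0`. The commutator consists of the curvature and `∇_{[X,Y]}`. By
the structure equation, `[e₁, e₂] = -ω(e₁) e₁ - ω(e₂) e₂` modulo `T`, and the unknown `T` part
disappears because `∇_T f = 0`. With `L = X² + Y² + ω(e₂) X - ω(e₁) Y`, what remains is `L|f|² ≥ 2
F(X, Y) |f|²`, where `F` is the curvature of the connection (`bochner`).

For `α` the curvature term is `da(e₁, e₂)`. The component of `β` satisfies the conjugate equation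
with connection form `ω + a`, so reversing `e₂` gives `-(dω + da)(e₁, e₂) = 2W - da(e₁, e₂)`, with
the same operator `L`. At a maximum of `u`, `Lu ≤ 0`. Substituting `da(e₁, e₂) = W + |α|² -
|β_{1̄}|²` yields `W (|α|² + |β_{1̄}|²) + (|α|² - |β_{1̄}|²)² ≤ 0`, so `u = 0` there
(`eq_zero_of_isLocalMax`). Compactness provides the maximum, and `norm_comp_eq` makes `u`
independent of the frame. -/

namespace ContactMonopole

/-! ### Second derivative test and Bochner inequality in a normed space -/

section Euclidean

/-- The second derivative test at a local maximum. -/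
theorem deriv_deriv_nonpos_of_isLocalMax {h h' : ℝ → ℝ} {d t : ℝ} (hmax : IsLocalMax h t)
    (h1 : ∀ᶠ s in nhds t, HasDerivAt h (h' s) s) (h2 : HasDerivAt h' d t) : d ≤ 0 := by
  -- If `d` were positive, `t` would be a local minimum as well as a local maximum, so `h` would be
  -- constant near `t` and `d` would be zero.
  by_contra! hd
  have hd1 : deriv h =ᶠ[nhds t] h' := h1.mono fun s hs => hs.deriv
  have hdd : deriv (deriv h) t = d := by rw [hd1.deriv_eq, h2.deriv]
  have hmin : IsLocalMin h t :=
    isLocalMin_of_deriv_deriv_pos (by rw [hdd]; exact hd) hmax.deriv_eq_zero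
      h1.self_of_nhds.continuousAt
  have hconst : h =ᶠ[nhds t] fun _ => h t := by
    filter_upwards [hmax, hmin] with s hs hs'
    exact le_antisymm hs hs'
  have : deriv (deriv h) t = 0 := by
    rw [hconst.deriv.deriv_eq]
    simp
  linarith

variable {E : Type*} [NormedAddCommGroup E] [NormedSpace ℝ E]

/-- The second derivative of a function in any direction is nonpositive at a local maximum. -/
theorem fderiv_fderiv_nonpos_of_isLocalMax {u : E → ℝ} {p : E} (hmax : IsLocalMax u p)
    (hu : ContDiffAt ℝ 2 u p) (v : E) : fderiv ℝ (fderiv ℝ u) p v v ≤ 0 := by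
  have hline : ∀ s : ℝ, HasDerivAt (fun s : ℝ => p + s • v) v s := fun s => by
    simpa using ((hasDerivAt_id s).smul_const v).const_add p
  have hp : p + (0 : ℝ) • v = p := by simp
  have hc : Filter.Tendsto (fun s : ℝ => p + s • v) (nhds 0) (nhds p) := by
    have := (hline 0).continuousAt
    rwa [ContinuousAt, hp] at this
  have hdiff : ∀ᶠ y in nhds p, DifferentiableAt ℝ u y := by
    have := (hu.of_le (m := 1) (by norm_num)).eventually (by simp)
    exact this.mono fun y hy => hy.differentiableAt (by simp)
  have hdd : DifferentiableAt ℝ (fderiv ℝ u) p :=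
    (hu.fderiv_right (m := 1) (by norm_num)).differentiableAt (by simp)
  refine deriv_deriv_nonpos_of_isLocalMax (h := fun s : ℝ => u (p + s • v)) (t := 0)
    (h' := fun s => fderiv ℝ u (p + s • v) v) ?_ ?_ ?_
  · have := hc.eventually hmax
    simpa [IsLocalMax, IsMaxFilter] using this
  · filter_upwards [hc.eventually hdiff] with s hs
    exact hs.hasFDerivAt.comp_hasDerivAt s (hline s)
  · have h2 : HasFDerivAt (fderiv ℝ u) (fderiv ℝ (fderiv ℝ u) p) (p + (0 : ℝ) • v) := by
      rw [hp]; exact hdd.hasFDerivAt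
    have h3 := h2.comp_hasDerivAt (0 : ℝ) (hline 0)
    exact ((ContinuousLinearMap.apply ℝ ℝ v).hasFDerivAt.comp_hasDerivAt (0 : ℝ) h3)

theorem fderiv_norm_sq_apply {f : E → ℂ} {y : E} (hf : DifferentiableAt ℝ f y) (v : E) :
    fderiv ℝ (fun y => ‖f y‖ ^ 2) y v = 2 * inner ℝ (f y) (fderiv ℝ f y v) := by
  rw [hf.hasFDerivAt.norm_sq.fderiv]
  simp
  ring

theorem fderiv_fderiv_norm_sq_apply {f : E → ℂ} {p : E} (hf : ContDiffAt ℝ 2 f p) (v : E) :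
    fderiv ℝ (fderiv ℝ (fun y => ‖f y‖ ^ 2)) p v v =
      2 * (inner ℝ (f p) (fderiv ℝ (fderiv ℝ f) p v v) + ‖fderiv ℝ f p v‖ ^ 2) := by
  have hu : ContDiffAt ℝ 2 (fun y => ‖f y‖ ^ 2) p := hf.norm_sq ℝ
  have hud : DifferentiableAt ℝ (fderiv ℝ (fun y => ‖f y‖ ^ 2)) p :=
    (hu.fderiv_right (m := 1) (by norm_num)).differentiableAt (by simp)
  have hfd : DifferentiableAt ℝ (fderiv ℝ f) p :=
    (hf.fderiv_right (m := 1) (by norm_num)).differentiableAt (by simp)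
  have hdiff : ∀ᶠ y in nhds p, DifferentiableAt ℝ f y := by
    have := (hf.of_le (m := 1) (by norm_num)).eventually (by simp)
    exact this.mono fun y hy => hy.differentiableAt (by simp)
  have h1 : (fun y => fderiv ℝ (fun y => ‖f y‖ ^ 2) y v) =ᶠ[nhds p]
      fun y => 2 * inner ℝ (f y) (fderiv ℝ f y v) := by
    filter_upwards [hdiff] with y hy using fderiv_norm_sq_apply hy v
  have h2 : fderiv ℝ (fun y => fderiv ℝ (fun y => ‖f y‖ ^ 2) y v) p v =
      fderiv ℝ (fderiv ℝ (fun y => ‖f y‖ ^ 2)) p v v := by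
    rw [fderiv_clm_apply hud (differentiableAt_const v)]
    simp
  have hv : HasFDerivAt (fun y => fderiv ℝ f y v) ((fderiv ℝ (fderiv ℝ f) p).flip v) p := by
    simpa using hfd.hasFDerivAt.clm_apply (hasFDerivAt_const v p)
  rw [← h2, h1.fderiv_eq,
    ((hdiff.self_of_nhds.hasFDerivAt.inner ℝ hv).const_mul 2).fderiv]
  simp [fderivInnerCLM_apply]

/-- The algebraic core of the Bochner inequality. -/
theorem bochner_algebra {f F₁ F₂ H₁₁ H₁₂ H₂₂ X₁ X₂ Y₁ Y₂ D : ℂ}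
    {a₁ a₂ A₁₁ A₁₂ A₂₁ A₂₂ x₁ x₂ y₁ y₂ d w₁ w₂ c : ℝ}
    (h0 : F₁ + Complex.I * a₁ * f + Complex.I * (F₂ + Complex.I * a₂ * f) = 0)
    (h1 : (H₁₁ + X₁ + Complex.I * ((A₁₁ + x₁) * f + a₁ * F₁)) +
      Complex.I * (H₁₂ + Y₁ + Complex.I * ((A₁₂ + y₁) * f + a₂ * F₁)) = 0)
    (h2 : (H₁₂ + X₂ + Complex.I * ((A₂₁ + x₂) * f + a₁ * F₂)) +
      Complex.I * (H₂₂ + Y₂ + Complex.I * ((A₂₂ + y₂) * f + a₂ * F₂)) = 0)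
    (hD : D + Complex.I * d * f = 0)
    (hF : Y₁ - X₂ = -w₁ * F₁ - w₂ * F₂ + c * D)
    (ha : y₁ - x₂ = -w₁ * a₁ - w₂ * a₂ + c * d) :
    (A₁₂ - A₂₁) * ‖f‖ ^ 2 ≤ (inner ℝ f H₁₁ + ‖F₁‖ ^ 2) + (inner ℝ f H₂₂ + ‖F₂‖ ^ 2) +
      inner ℝ f (X₁ + Y₂ + w₂ * F₁ - w₁ * F₂) := by
  -- Here `z = ∇_X f`; by `h0`, `∇_Y f = i z`.
  obtain ⟨z, rfl⟩ : ∃ z, F₁ = z - Complex.I * a₁ * f := ⟨F₁ + Complex.I * a₁ * f, by ring⟩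
  obtain rfl : F₂ = Complex.I * z - Complex.I * a₂ * f := by
    linear_combination (-Complex.I) * h0 + (F₂ + Complex.I * a₂ * f) * Complex.I_sq
  obtain rfl : D = -(Complex.I * d * f) := by linear_combination hD
  obtain rfl := sub_eq_iff_eq_add.mp hF
  obtain rfl := sub_eq_iff_eq_add.mp ha
  have h1r := congrArg Complex.re h1
  have h1i := congrArg Complex.im h1
  have h2r := congrArg Complex.re h2
  have h2i := congrArg Complex.im h2
  simp at h1r h1i h2r h2i
  have hn : ∀ w : ℂ, ‖w‖ ^ 2 = w.re ^ 2 + w.im ^ 2 := fun w => by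
    rw [Complex.sq_norm, Complex.normSq_apply]; ring
  have hi : ∀ w w' : ℂ, (inner ℝ w w' : ℝ) = w.re * w'.re + w.im * w'.im := fun w w' => by
    rw [Complex.inner]; simp; ring
  rw [← sub_nonneg]
  simp only [hn, hi]
  simp only [Complex.add_re, Complex.sub_re, Complex.mul_re, Complex.add_im, Complex.sub_im,
    Complex.mul_im, Complex.ofReal_re, Complex.ofReal_im, Complex.I_re, Complex.I_im]
  -- The inequality is an identity up to the discarded term `|∇_X f|² + |∇_Y f|² = 2|z|²`.
  have hz : 0 ≤ 2 * (z.re ^ 2 + z.im ^ 2) := by positivity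
  refine hz.trans_eq ?_
  -- The combination is `-Re(f̄ (h1 - i h2))`: the operator `X - iY` applied to the first-order
  -- equation, paired with `f`.
  linear_combination (-f.re) * (h1r + h2i) - f.im * (h1i - h2r)

/-- The Bochner inequality for a function `f` which is holomorphic along `X + i Y` and parallel
along `T` with respect to the connection `d + i a`. -/
theorem bochner {f : E → ℂ} {a : E → E →L[ℝ] ℝ} {X Y : E → E} {p T : E} {w₁ w₂ c : ℝ}
    (hf : ContDiffAt ℝ 2 f p) (ha : DifferentiableAt ℝ a p) (hX : DifferentiableAt ℝ X p)
    (hY : DifferentiableAt ℝ Y p)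
    (heq : ∀ᶠ y in nhds p, fderiv ℝ f y (X y) + Complex.I * a y (X y) * f y +
      Complex.I * (fderiv ℝ f y (Y y) + Complex.I * a y (Y y) * f y) = 0)
    (hT : fderiv ℝ f p T + Complex.I * a p T * f p = 0)
    (hbr : fderiv ℝ Y p (X p) - fderiv ℝ X p (Y p) = -(w₁ • X p) - w₂ • Y p + c • T) :
    2 * ((fderiv ℝ a p (X p) (Y p) - fderiv ℝ a p (Y p) (X p)) * ‖f p‖ ^ 2) ≤
      fderiv ℝ (fderiv ℝ (fun y => ‖f y‖ ^ 2)) p (X p) (X p) +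
      fderiv ℝ (fderiv ℝ (fun y => ‖f y‖ ^ 2)) p (Y p) (Y p) +
      fderiv ℝ (fun y => ‖f y‖ ^ 2) p
        (fderiv ℝ X p (X p) + fderiv ℝ Y p (Y p) + w₂ • X p - w₁ • Y p) := by
  have hfd : DifferentiableAt ℝ f p := hf.differentiableAt (by simp)
  have hfdd : DifferentiableAt ℝ (fderiv ℝ f) p :=
    (hf.fderiv_right (m := 1) (by norm_num)).differentiableAt (by simp)
  have hsymm : ∀ v w, fderiv ℝ (fderiv ℝ f) p v w = fderiv ℝ (fderiv ℝ f) p w v :=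
    hf.isSymmSndFDerivAt (by simp)
  have hcov : ∀ {Z : E → E}, DifferentiableAt ℝ Z p →
      HasFDerivAt (fun y => fderiv ℝ f y (Z y) + Complex.I * a y (Z y) * f y)
        (((fderiv ℝ f p).comp (fderiv ℝ Z p) + (fderiv ℝ (fderiv ℝ f) p).flip (Z p)) +
          ((Complex.I * a p (Z p)) • fderiv ℝ f p +
            f p • (Complex.I • Complex.ofRealCLM.comp
              ((a p).comp (fderiv ℝ Z p) + (fderiv ℝ a p).flip (Z p))))) p := by
    intro Z hZ
    refine (hfdd.hasFDerivAt.clm_apply hZ.hasFDerivAt).add (HasFDerivAt.mul ?_ hfd.hasFDerivAt)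
    exact (Complex.ofRealCLM.hasFDerivAt.comp p
      (ha.hasFDerivAt.clm_apply hZ.hasFDerivAt)).const_mul Complex.I
  have hder := ((hcov hX).add ((hcov hY).const_mul Complex.I)).fderiv
  -- The equation holds near `p`, so it can be differentiated; its derivatives along `X p` and `Y p`
  -- are the second-order relations `h1` and `h2`.
  have hzero := hder.symm.trans (Filter.EventuallyEq.fderiv_eq (f := fun _ : E => (0 : ℂ)) heq)
  rw [fderiv_fun_const] at hzero
  have h1 := congrArg (fun L => L (X p)) hzero
  have h2 := congrArg (fun L => L (Y p)) hzero
  have hF := congrArg (fun v => fderiv ℝ f p v) hbr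
  have hA := congrArg (fun v => a p v) hbr
  simp only [map_sub, map_add, map_neg, map_smul, smul_eq_mul] at hA
  simp only [map_sub, map_add, map_neg, map_smul, Complex.real_smul] at hF
  simp at h1 h2
  rw [fderiv_fderiv_norm_sq_apply hf, fderiv_fderiv_norm_sq_apply hf, fderiv_norm_sq_apply hfd]
  simp only [map_sub, map_add, map_smul, Complex.real_smul]
  have key := bochner_algebra (f := f p) (F₁ := fderiv ℝ f p (X p)) (F₂ := fderiv ℝ f p (Y p))
    (H₁₁ := fderiv ℝ (fderiv ℝ f) p (X p) (X p)) (H₁₂ := fderiv ℝ (fderiv ℝ f) p (X p) (Y p))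
    (H₂₂ := fderiv ℝ (fderiv ℝ f) p (Y p) (Y p))
    (X₁ := fderiv ℝ f p (fderiv ℝ X p (X p))) (X₂ := fderiv ℝ f p (fderiv ℝ X p (Y p)))
    (Y₁ := fderiv ℝ f p (fderiv ℝ Y p (X p))) (Y₂ := fderiv ℝ f p (fderiv ℝ Y p (Y p)))
    (D := fderiv ℝ f p T) (a₁ := a p (X p)) (a₂ := a p (Y p))
    (A₁₁ := fderiv ℝ a p (X p) (X p)) (A₁₂ := fderiv ℝ a p (X p) (Y p))
    (A₂₁ := fderiv ℝ a p (Y p) (X p)) (A₂₂ := fderiv ℝ a p (Y p) (Y p))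
    (x₁ := a p (fderiv ℝ X p (X p))) (x₂ := a p (fderiv ℝ X p (Y p)))
    (y₁ := a p (fderiv ℝ Y p (X p))) (y₂ := a p (fderiv ℝ Y p (Y p)))
    (d := a p T) (w₁ := w₁) (w₂ := w₂) (c := c) heq.self_of_nhds
    (by linear_combination h1) (by rw [hsymm (X p) (Y p)]; linear_combination h2) hT
    (by linear_combination hF) (by linear_combination hA)
  linarith

end Euclidean

/-! ### Fields, forms and covariant derivatives read in a chart -/

section Chart

variable {M : Type*} [TopologicalSpace M] [ChartedSpace E3 M] [IsManifold (𝓡 3) ∞ M]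

/-- The vector field `X` read in the chart at `x₀`. -/
def chartField (X : VField M) (x₀ : M) (y : E3) : E3 :=
  mfderiv (𝓡 3) 𝓘(ℝ, E3) (extChartAt (𝓡 3) x₀) ((extChartAt (𝓡 3) x₀).symm y)
    (X ((extChartAt (𝓡 3) x₀).symm y))

theorem mfderiv_extChartAt_symm_apply {x₀ x : M} (hx : x ∈ (extChartAt (𝓡 3) x₀).source)
    (v : Tan x) :
    mfderiv 𝓘(ℝ, E3) (𝓡 3) (extChartAt (𝓡 3) x₀).symm (extChartAt (𝓡 3) x₀ x)
      (mfderiv (𝓡 3) 𝓘(ℝ, E3) (extChartAt (𝓡 3) x₀) x v) = v := by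
  have h := mfderivWithin_extChartAt_symm_comp_mfderiv_extChartAt' (I := 𝓡 3) hx
  rw [ModelWithCorners.Boundaryless.range_eq_univ, mfderivWithin_univ] at h
  exact congrArg (fun L => L v) h

theorem chartForm_apply_chartField (η : OneForm M) (X : VField M) {x₀ : M} {y : E3}
    (hy : y ∈ (extChartAt (𝓡 3) x₀).target) :
    chartForm η x₀ y (chartField X x₀ y) =
      η ((extChartAt (𝓡 3) x₀).symm y) (X ((extChartAt (𝓡 3) x₀).symm y)) := by
  have h := mfderiv_extChartAt_symm_apply ((extChartAt (𝓡 3) x₀).map_target hy)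
    (X ((extChartAt (𝓡 3) x₀).symm y))
  rw [(extChartAt (𝓡 3) x₀).right_inv hy] at h
  exact congrArg (η ((extChartAt (𝓡 3) x₀).symm y)) h

omit [IsManifold (𝓡 3) ∞ M] in
/-- Smooth functions are smooth in charts. -/
theorem contDiffAt_comp_extChartAt_symm {F : Type*} [NormedAddCommGroup F] [NormedSpace ℝ F]
    {f : M → F} {x₀ : M} (hf : ContMDiffAt (𝓡 3) 𝓘(ℝ, F) ∞ f x₀) :
    ContDiffAt ℝ ∞ (f ∘ (extChartAt (𝓡 3) x₀).symm) (extChartAt (𝓡 3) x₀ x₀) := by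
  have h := (contMDiffAt_iff.mp hf).2
  rw [ModelWithCorners.Boundaryless.range_eq_univ, contDiffWithinAt_univ] at h
  simpa only [extChartAt_model_space_eq_id, PartialEquiv.refl_coe, Function.id_comp] using h

theorem contDiffAt_chartField {X : VField M} {U : Set M} (hU : IsOpen U) (hX : SmoothFieldOn X U)
    {x₀ : M} (hx₀ : x₀ ∈ U) :
    ContDiffAt ℝ ∞ (chartField X x₀) (extChartAt (𝓡 3) x₀ x₀) := by
  have h := hX.contMDiffAt (hU.mem_nhds hx₀)
  rw [Bundle.contMDiffAt_section] at h
  refine (contDiffAt_comp_extChartAt_symm h).congr_of_eventuallyEq ?_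
  filter_upwards [extChartAt_target_mem_nhds (I := 𝓡 3) x₀] with y hy
  have hy' := (extChartAt (𝓡 3) x₀).map_target hy
  rw [extChartAt_source] at hy'
  -- The trivialization of the tangent bundle at `x₀` is the derivative of the chart at `x₀`, so the
  -- trivialized section is `chartField`.
  have h2 := congrArg (fun L => L (X ((extChartAt (𝓡 3) x₀).symm y)))
    (TangentBundle.continuousLinearMapAt_trivializationAt (I := 𝓡 3) hy')
  refine h2.symm.trans ?_
  simp only [Bundle.Trivialization.continuousLinearMapAt_apply,
    Bundle.Trivialization.linearMapAt_apply]
  rw [if_pos (by simpa using hy')]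
  rfl

theorem contDiffAt_chartForm {η : OneForm M} {U : Set M} (hU : IsOpen U) (hη : SmoothFormOn η U)
    {x₀ : M} (hx₀ : x₀ ∈ U) :
    ContDiffAt ℝ ∞ (chartForm η x₀) (extChartAt (𝓡 3) x₀ x₀) := by
  have h := hη.contMDiffAt (hU.mem_nhds hx₀)
  rw [contMDiffAt_hom_bundle] at h
  refine (contDiffAt_comp_extChartAt_symm h.2).congr_of_eventuallyEq ?_
  filter_upwards [extChartAt_target_mem_nhds (I := 𝓡 3) x₀] with y hy
  have hy' := (extChartAt (𝓡 3) x₀).map_target hy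
  rw [extChartAt_source] at hy'
  have h2 := TangentBundle.symmL_trivializationAt (I := 𝓡 3) hy'
  rw [ModelWithCorners.Boundaryless.range_eq_univ, mfderivWithin_univ,
    (extChartAt (𝓡 3) x₀).right_inv hy] at h2
  simp only [chartForm, Function.comp, ContinuousLinearMap.inCoordinates]
  ext v
  rw [h2]
  simp

/-- The derivative of a function on `M`, read in a chart. -/
theorem fderiv_comp_extChartAt_symm {f : M → ℂ} {x₀ : M} {y : E3}
    (hy : y ∈ (extChartAt (𝓡 3) x₀).target)
    (hf : MDifferentiableAt (𝓡 3) 𝓘(ℝ, ℂ) f ((extChartAt (𝓡 3) x₀).symm y)) (X : VField M) :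
    fderiv ℝ (f ∘ (extChartAt (𝓡 3) x₀).symm) y (chartField X x₀ y) =
      dirDeriv f ((extChartAt (𝓡 3) x₀).symm y) (X ((extChartAt (𝓡 3) x₀).symm y)) := by
  have hs : MDifferentiableAt 𝓘(ℝ, E3) (𝓡 3) (extChartAt (𝓡 3) x₀).symm y := by
    have := mdifferentiableWithinAt_extChartAt_symm (I := 𝓡 3) hy
    rwa [ModelWithCorners.Boundaryless.range_eq_univ, mdifferentiableWithinAt_univ] at this
  have h := mfderiv_extChartAt_symm_apply ((extChartAt (𝓡 3) x₀).map_target hy)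
    (X ((extChartAt (𝓡 3) x₀).symm y))
  rw [(extChartAt (𝓡 3) x₀).right_inv hy] at h
  rw [← mfderiv_eq_fderiv, mfderiv_comp y hf hs]
  exact congrArg (mfderiv (𝓡 3) 𝓘(ℝ, ℂ) f ((extChartAt (𝓡 3) x₀).symm y)) h

/-- The covariant derivative, read in a chart. -/
theorem covD_eq_chart {f : M → ℂ} (A : OneForm M) {x₀ : M} {y : E3}
    (hy : y ∈ (extChartAt (𝓡 3) x₀).target)
    (hf : MDifferentiableAt (𝓡 3) 𝓘(ℝ, ℂ) f ((extChartAt (𝓡 3) x₀).symm y)) (X : VField M) :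
    covD A f ((extChartAt (𝓡 3) x₀).symm y) (X ((extChartAt (𝓡 3) x₀).symm y)) =
      fderiv ℝ (f ∘ (extChartAt (𝓡 3) x₀).symm) y (chartField X x₀ y) +
        Complex.I * chartForm A x₀ y (chartField X x₀ y) *
          (f ∘ (extChartAt (𝓡 3) x₀).symm) y := by
  rw [fderiv_comp_extChartAt_symm hy hf, chartForm_apply_chartField A X hy]
  rfl

-- Stated only at the centre of the chart: `extD` at a point is computed in the chart of that same
-- point.
omit [IsManifold (𝓡 3) ∞ M] in
theorem extD_eq_chart (η : OneForm M) (X Y : VField M) (x₀ : M) :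
    extD η x₀ (X x₀) (Y x₀) =
      fderiv ℝ (chartForm η x₀) (extChartAt (𝓡 3) x₀ x₀)
          (chartField X x₀ (extChartAt (𝓡 3) x₀ x₀)) (chartField Y x₀ (extChartAt (𝓡 3) x₀ x₀)) -
        fderiv ℝ (chartForm η x₀) (extChartAt (𝓡 3) x₀ x₀)
          (chartField Y x₀ (extChartAt (𝓡 3) x₀ x₀))
          (chartField X x₀ (extChartAt (𝓡 3) x₀ x₀)) := by
  simp only [extD, chartField]
  rw [extChartAt_to_inv]

end Chart

/-! ### Exterior derivative and Lie bracket -/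

section Bracket

variable {E : Type*} [NormedAddCommGroup E] [NormedSpace ℝ E]

/-- `dη(X, Y) = -η([X, Y])` when `η(X)` and `η(Y)` are locally constant. -/
theorem apply_bracket_of_eventually_const {η : E → E →L[ℝ] ℝ} {X Y : E → E} {p : E} {r s : ℝ}
    (hη : DifferentiableAt ℝ η p) (hX : DifferentiableAt ℝ X p) (hY : DifferentiableAt ℝ Y p)
    (hr : ∀ᶠ y in nhds p, η y (X y) = r) (hs : ∀ᶠ y in nhds p, η y (Y y) = s) :
    η p (fderiv ℝ Y p (X p) - fderiv ℝ X p (Y p)) =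
      -(fderiv ℝ η p (X p) (Y p) - fderiv ℝ η p (Y p) (X p)) := by
  -- Product rule for the locally constant function `η(Z)`.
  have key : ∀ {Z : E → E} {t : ℝ}, DifferentiableAt ℝ Z p → (∀ᶠ y in nhds p, η y (Z y) = t) →
      ∀ v, η p (fderiv ℝ Z p v) + fderiv ℝ η p v (Z p) = 0 := by
    intro Z t hZ ht v
    have h := (hη.hasFDerivAt.clm_apply hZ.hasFDerivAt).fderiv.symm.trans
      (Filter.EventuallyEq.fderiv_eq (f := fun _ : E => t) ht)
    rw [fderiv_fun_const] at h
    simpa using congrArg (fun L => L v) h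
  rw [map_sub]
  linarith [key hX hr (Y p), key hY hs (X p)]

end Bracket

/-! ### Unitary frames and the vanishing of monopoles at a maximum -/

section Frames

variable {M : Type*} [TopologicalSpace M] [ChartedSpace E3 M] [IsManifold (𝓡 3) ∞ M]

-- An alternating bilinear form scales by the determinant of the change of vectors.
omit [IsManifold (𝓡 3) ∞ M] in
theorem extD_combination (η : OneForm M) (x : M) (u v : Tan x) (r s t q : ℝ) :
    extD η x (r • u + s • v) (t • u + q • v) = (r * q - s * t) * extD η x u v := by
  have key : ∀ (L : E3 →L[ℝ] E3 →L[ℝ] ℝ) (u' v' : E3),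
      L (r • u' + s • v') (t • u' + q • v') - L (t • u' + q • v') (r • u' + s • v') =
        (r * q - s * t) * (L u' v' - L v' u') := by
    intro L u' v'
    simp
    ring
  have hlin : ∀ r s : ℝ, mfderiv (𝓡 3) 𝓘(ℝ, E3) (extChartAt (𝓡 3) x) x (r • u + s • v) =
      r • mfderiv (𝓡 3) 𝓘(ℝ, E3) (extChartAt (𝓡 3) x) x u +
        s • mfderiv (𝓡 3) 𝓘(ℝ, E3) (extChartAt (𝓡 3) x) x v := fun r s => by
    rw [map_add, map_smul, map_smul]
  unfold extD
  rw [hlin, hlin]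
  exact key _ _ _

variable {ξ : OrientedContactStructure M} {P : OrientedPseudohermitian ξ}

theorem OrientedPseudohermitian.exists_combination {x : M} {e : ξ.plane x} (he : e ≠ 0)
    (v : ξ.plane x) : ∃ r s : ℝ, v = r • e + s • P.J x e := by
  obtain ⟨b, hb0, hb1, -⟩ := P.J_oriented x e he
  refine ⟨b.repr v 0, b.repr v 1, ?_⟩
  conv_lhs => rw [← b.sum_repr v]
  rw [Fin.sum_univ_two, hb0, hb1]

/-- `J` sends `r e + s Je` to `-s e + r Je`, and these two vectors have determinant `r² + s²`
relative to `(e, Je)`. -/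
theorem OrientedPseudohermitian.h_combination (x : M) (e : ξ.plane x) (r s : ℝ) :
    P.h x (r • e + s • P.J x e) (r • e + s • P.J x e) = (r ^ 2 + s ^ 2) * P.h x e e := by
  have h1 : P.J x (r • e + s • P.J x e) = (-s) • e + r • P.J x e := by
    rw [map_add, map_smul, map_smul, P.J_sq]; module
  rw [OrientedPseudohermitian.h, h1, OrientedPseudohermitian.h]
  have h2 := extD_combination P.θ x (e : Tan x) (P.J x e : Tan x) r s (-s) r
  simp only [Submodule.coe_add, Submodule.coe_smul]
  rw [h2]
  ring

namespace UnitaryFrame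

variable (F : UnitaryFrame P)

theorem e₁_ne_zero {x : M} (hx : x ∈ F.U) : F.e₁ x ≠ 0 := by
  intro h
  have h1 := F.e₁_unit x hx
  rw [h, OrientedPseudohermitian.h] at h1
  simp [extD] at h1

/-- A `(0,1)`-form is determined by its value on `e₁`, since `e₁` and `J e₁` span `ξ`. -/
theorem form_eq_zero_of_comp_eq_zero {β : ZeroOneForm P} {x : M} (hx : x ∈ F.U)
    (h : F.comp β x = 0) : β.form x = 0 := by
  have h1 : β.form x (F.e₁ x) = 0 := by simpa [comp] using h
  ext v
  obtain ⟨r, s, rfl⟩ := P.exists_combination (F.e₁_ne_zero hx) v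
  simp [β.type_zero_one, h1]

/-- The norm of the component of a `(0,1)`-form does not depend on the unitary frame. -/
theorem norm_comp_eq (F' : UnitaryFrame P) (β : ZeroOneForm P) {x : M} (hx : x ∈ F.U)
    (hx' : x ∈ F'.U) : ‖F'.comp β x‖ ^ 2 = ‖F.comp β x‖ ^ 2 := by
  -- Both frames are unit, so `r² + s² = 1`, and type `(0,1)` turns the rotation into multiplication
  -- by the unit number `r - i s`.
  obtain ⟨r, s, hrs⟩ := P.exists_combination (F.e₁_ne_zero hx) (F'.e₁ x)
  have h1 := F'.e₁_unit x hx'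
  rw [hrs, P.h_combination, F.e₁_unit x hx, mul_one] at h1
  have h2 : F'.comp β x = ((r : ℂ) - s * Complex.I) * F.comp β x := by
    simp only [comp, hrs, map_add, map_smul, β.type_zero_one, Complex.real_smul]
    ring
  have h3 : ‖(r : ℂ) - s * Complex.I‖ ^ 2 = 1 := by
    rw [← h1, Complex.sq_norm, Complex.normSq_apply]
    simp
    ring
  rw [h2, norm_mul, mul_pow, h3, one_mul]

/-- A tangent vector is determined by its coframe components. -/
theorem eq_combination {x : M} (hx : x ∈ F.U) (v : Tan x) :
    v = P.θ x v • F.T x + F.ε₁ x v • (F.e₁ x : Tan x) + F.ε₂ x v • (F.e₂ x : Tan x) := by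
  have hmem : v - P.θ x v • F.T x ∈ ξ.plane x := by
    rw [P.mem_plane_iff, map_sub, map_smul, F.θ_T x hx]; simp
  obtain ⟨r, s, hrs⟩ := P.exists_combination (F.e₁_ne_zero hx) ⟨_, hmem⟩
  rw [← F.e₂_eq x hx] at hrs
  have hv : v = P.θ x v • F.T x + r • (F.e₁ x : Tan x) + s • (F.e₂ x : Tan x) := by
    have := congrArg Subtype.val hrs
    simp only [Submodule.coe_add, Submodule.coe_smul] at this
    rw [add_assoc, ← this]; abel
  obtain ⟨a1, a2, a3⟩ := F.ε₁_dual x hx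
  obtain ⟨b1, b2, b3⟩ := F.ε₂_dual x hx
  have hr : F.ε₁ x v = r := by
    rw [hv]; simp only [map_add, map_smul, a1, a2, a3]; simp
  have hs : F.ε₂ x v = s := by
    rw [hv]; simp only [map_add, map_smul, b1, b2, b3]; simp
  rw [hr, hs]
  exact hv

theorem e₂_smooth : SmoothFieldOn (fun x => (F.e₂ x : Tan x)) F.U := by
  refine (P.J_smooth F.U F.isOpen F.e₁ F.e₁_smooth).congr fun x hx => ?_
  simp only [F.e₂_eq x hx]

theorem comp_smooth (β : ZeroOneForm P) : ContMDiffOn (𝓡 3) 𝓘(ℝ, ℂ) ∞ (F.comp β) F.U :=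
  (ContinuousLinearMap.mul ℝ ℂ (Real.sqrt 2 : ℂ)).contMDiff.comp_contMDiffOn
    (β.smooth F.U F.isOpen F.e₁ F.e₁_smooth)

/-- The structure equation on the contact plane: `dε_i(e₁, e₂) = ω(e_i)`. -/
theorem extD_coframe {x : M} (hx : x ∈ F.U) :
    extD F.ε₁ x (F.e₁ x : Tan x) (F.e₂ x : Tan x) = F.conn x (F.e₁ x : Tan x) ∧
      extD F.ε₂ x (F.e₁ x : Tan x) (F.e₂ x : Tan x) = F.conn x (F.e₂ x : Tan x) := by
  -- The torsion term drops out because `θ` vanishes on `ξ`; the right-hand side becomes `ω(e₁) + i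
  -- ω(e₂)`.
  have h := F.structure_eq x hx (F.e₁ x : Tan x) (F.e₂ x : Tan x)
  obtain ⟨-, a2, a3⟩ := F.ε₁_dual x hx
  obtain ⟨-, b2, b3⟩ := F.ε₂_dual x hx
  rw [a2, a3, b2, b3, (P.mem_plane_iff x _).mp (F.e₁ x).2,
    (P.mem_plane_iff x _).mp (F.e₂ x).2] at h
  have hr := congrArg Complex.re h
  have hi := congrArg Complex.im h
  simp at hr hi
  exact ⟨hr, hi⟩

theorem eq_combination_chart {x₀ : M} {y : E3} (hy : y ∈ (extChartAt (𝓡 3) x₀).target)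
    (hyU : (extChartAt (𝓡 3) x₀).symm y ∈ F.U) (V : E3) :
    V = chartForm P.θ x₀ y V • chartField F.T x₀ y +
      chartForm F.ε₁ x₀ y V • chartField (fun x => (F.e₁ x : Tan x)) x₀ y +
      chartForm F.ε₂ x₀ y V • chartField (fun x => (F.e₂ x : Tan x)) x₀ y := by
  have h := mfderiv_extChartAt_comp_mfderivWithin_extChartAt_symm (I := 𝓡 3) hy
  rw [ModelWithCorners.Boundaryless.range_eq_univ, mfderivWithin_univ] at h
  have h1 := congrArg (fun L => L V) h
  have h2 := congrArg (mfderiv (𝓡 3) 𝓘(ℝ, E3) (extChartAt (𝓡 3) x₀)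
    ((extChartAt (𝓡 3) x₀).symm y)) (F.eq_combination hyU
      (mfderiv 𝓘(ℝ, E3) (𝓡 3) (extChartAt (𝓡 3) x₀).symm y V))
  rw [map_add, map_add, map_smul, map_smul, map_smul] at h2
  exact h1.symm.trans h2

/-- `[e₁, e₂] = -ω(e₁) e₁ - ω(e₂) e₂` modulo `T`, read in the chart. -/
theorem bracket_chart {x₀ : M} (hx₀ : x₀ ∈ F.U) : ∃ c : ℝ,
    fderiv ℝ (chartField (fun x => (F.e₂ x : Tan x)) x₀) (extChartAt (𝓡 3) x₀ x₀)
        (chartField (fun x => (F.e₁ x : Tan x)) x₀ (extChartAt (𝓡 3) x₀ x₀)) -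
      fderiv ℝ (chartField (fun x => (F.e₁ x : Tan x)) x₀) (extChartAt (𝓡 3) x₀ x₀)
        (chartField (fun x => (F.e₂ x : Tan x)) x₀ (extChartAt (𝓡 3) x₀ x₀)) =
      -(F.conn x₀ (F.e₁ x₀ : Tan x₀) •
          chartField (fun x => (F.e₁ x : Tan x)) x₀ (extChartAt (𝓡 3) x₀ x₀)) -
        F.conn x₀ (F.e₂ x₀ : Tan x₀) •
          chartField (fun x => (F.e₂ x : Tan x)) x₀ (extChartAt (𝓡 3) x₀ x₀) +
        c • chartField F.T x₀ (extChartAt (𝓡 3) x₀ x₀) := by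
  have hnear : ∀ᶠ y in nhds (extChartAt (𝓡 3) x₀ x₀),
      y ∈ (extChartAt (𝓡 3) x₀).target ∧ (extChartAt (𝓡 3) x₀).symm y ∈ F.U := by
    refine Filter.Eventually.and (extChartAt_target_mem_nhds (I := 𝓡 3) x₀) ?_
    refine (continuousAt_extChartAt_symm (I := 𝓡 3) x₀).eventually_mem ?_
    rw [extChartAt_to_inv]
    exact F.isOpen.mem_nhds hx₀
  have hpair : ∀ (η : OneForm M) (X : VField M) (r : ℝ), (∀ x ∈ F.U, η x (X x) = r) →
      ∀ᶠ y in nhds (extChartAt (𝓡 3) x₀ x₀), chartForm η x₀ y (chartField X x₀ y) = r := by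
    intro η X r h
    filter_upwards [hnear] with y hy
    rw [chartForm_apply_chartField η X hy.1]
    exact h _ hy.2
  have h1 := (contDiffAt_chartField F.isOpen F.e₁_smooth hx₀).differentiableAt (by simp)
  have h2 := (contDiffAt_chartField F.isOpen F.e₂_smooth hx₀).differentiableAt (by simp)
  have b1 := apply_bracket_of_eventually_const
    ((contDiffAt_chartForm F.isOpen F.ε₁_smooth hx₀).differentiableAt (by simp)) h1 h2
    (hpair F.ε₁ _ 1 fun x hx => (F.ε₁_dual x hx).2.1)
    (hpair F.ε₁ _ 0 fun x hx => (F.ε₁_dual x hx).2.2)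
  have b2 := apply_bracket_of_eventually_const
    ((contDiffAt_chartForm F.isOpen F.ε₂_smooth hx₀).differentiableAt (by simp)) h1 h2
    (hpair F.ε₂ _ 0 fun x hx => (F.ε₂_dual x hx).2.1)
    (hpair F.ε₂ _ 1 fun x hx => (F.ε₂_dual x hx).2.2)
  rw [← extD_eq_chart F.ε₁ (fun x => (F.e₁ x : Tan x)) (fun x => (F.e₂ x : Tan x)) x₀,
    (F.extD_coframe hx₀).1] at b1
  rw [← extD_eq_chart F.ε₂ (fun x => (F.e₁ x : Tan x)) (fun x => (F.e₂ x : Tan x)) x₀,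
    (F.extD_coframe hx₀).2] at b2
  have h := F.eq_combination_chart hnear.self_of_nhds.1 hnear.self_of_nhds.2
    (fderiv ℝ (chartField (fun x => (F.e₂ x : Tan x)) x₀) (extChartAt (𝓡 3) x₀ x₀)
        (chartField (fun x => (F.e₁ x : Tan x)) x₀ (extChartAt (𝓡 3) x₀ x₀)) -
      fderiv ℝ (chartField (fun x => (F.e₁ x : Tan x)) x₀) (extChartAt (𝓡 3) x₀ x₀)
        (chartField (fun x => (F.e₂ x : Tan x)) x₀ (extChartAt (𝓡 3) x₀ x₀)))
  rw [b1, b2] at h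
  -- The witness is the `θ`-component of the bracket; its value plays no role, since it only
  -- multiplies derivatives along `T`.
  exact ⟨_, h.trans (by rw [neg_smul, neg_smul]; abel)⟩

/-- A Reeb-parallel monopole vanishes where `|α|² + |β|²` has a local maximum, if the
Tanaka–Webster curvature is positive there. -/
theorem eq_zero_of_isLocalMax {a : OneForm M} {α : M → ℂ} {β : ZeroOneForm P} {x₀ : M}
    (hx₀ : x₀ ∈ F.U) (ha : SmoothFormOn a Set.univ) (hα : ContMDiff (𝓡 3) 𝓘(ℝ, ℂ) ∞ α)
    (hsol : ∀ x ∈ F.U, F.MonopoleEqAt a α β x ∧ F.ReebParallelAt a α β x)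
    (hW : 0 < F.webster x₀)
    (hmax : IsLocalMax (fun x => ‖α x‖ ^ 2 + ‖F.comp β x‖ ^ 2) x₀) :
    α x₀ = 0 ∧ F.comp β x₀ = 0 := by
  set φ := extChartAt (𝓡 3) x₀
  set p := φ x₀
  have hpx : φ.symm p = x₀ := extChartAt_to_inv x₀
  have htend : Filter.Tendsto φ.symm (nhds p) (nhds x₀) := by
    have := continuousAt_extChartAt_symm (I := 𝓡 3) x₀
    rwa [ContinuousAt, extChartAt_to_inv] at this
  have hnear : ∀ᶠ y in nhds p, y ∈ φ.target ∧ φ.symm y ∈ F.U :=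
    Filter.Eventually.and (extChartAt_target_mem_nhds (I := 𝓡 3) x₀)
      (htend.eventually (F.isOpen.mem_nhds hx₀))
  set X := chartField (fun x => (F.e₁ x : Tan x)) x₀
  set Y := chartField (fun x => (F.e₂ x : Tan x)) x₀
  set Z := chartField F.T x₀
  have dX : DifferentiableAt ℝ X p :=
    (contDiffAt_chartField F.isOpen F.e₁_smooth hx₀).differentiableAt (by simp)
  have dY : DifferentiableAt ℝ Y p :=
    (contDiffAt_chartField F.isOpen F.e₂_smooth hx₀).differentiableAt (by simp)
  have da : DifferentiableAt ℝ (chartForm a x₀) p :=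
    (contDiffAt_chartForm isOpen_univ ha (Set.mem_univ x₀)).differentiableAt (by simp)
  have dω : DifferentiableAt ℝ (chartForm F.conn x₀) p :=
    (contDiffAt_chartForm F.isOpen F.conn_smooth hx₀).differentiableAt (by simp)
  have htw : chartForm (F.twist a) x₀ = chartForm F.conn x₀ + chartForm a x₀ := by
    funext y
    exact ContinuousLinearMap.add_comp _ _ _
  have dA : DifferentiableAt ℝ (chartForm (F.twist a) x₀) p := by
    rw [htw]; exact dω.add da
  set f : E3 → ℂ := α ∘ φ.symm with hf
  set g : E3 → ℂ := F.comp β ∘ φ.symm with hg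
  have cf : ContDiffAt ℝ 2 f p :=
    (contDiffAt_comp_extChartAt_symm hα.contMDiffAt).of_le
      (WithTop.coe_le_coe.2 (le_top : (2 : ℕ∞) ≤ ⊤))
  have cg : ContDiffAt ℝ 2 g p :=
    (contDiffAt_comp_extChartAt_symm
      ((F.comp_smooth β).contMDiffAt (F.isOpen.mem_nhds hx₀))).of_le
      (WithTop.coe_le_coe.2 (le_top : (2 : ℕ∞) ≤ ⊤))
  have mα : ∀ x, MDifferentiableAt (𝓡 3) 𝓘(ℝ, ℂ) α x := fun x =>
    hα.contMDiffAt.mdifferentiableAt (by simp)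
  have mβ : ∀ x ∈ F.U, MDifferentiableAt (𝓡 3) 𝓘(ℝ, ℂ) (F.comp β) x := fun x hx =>
    ((F.comp_smooth β).contMDiffAt (F.isOpen.mem_nhds hx)).mdifferentiableAt (by simp)
  obtain ⟨c, hbr⟩ := F.bracket_chart hx₀
  obtain ⟨hp1, hp2⟩ := hnear.self_of_nhds
  have bα := bochner (T := Z p) cf da dX dY
    (by
      filter_upwards [hnear] with y hy
      have h := (hsol _ hy.2).1.1
      rw [alphaBar, covD_eq_chart a hy.1 (mα _) fun x => (F.e₁ x : Tan x),
        covD_eq_chart a hy.1 (mα _) fun x => (F.e₂ x : Tan x)] at h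
      linear_combination 2 * h)
    (by
      have h := (hsol _ hp2).2.1
      rwa [alphaZero, covD_eq_chart a hp1 (mα _) F.T] at h)
    hbr
  -- `β_{1̄}` is annihilated by `∇_X - i ∇_Y`, so `Y` is replaced by `-Y`. The bracket changes sign,
  -- which forces `w₁` and `c` to change sign while `w₂` stays.
  have bβ := bochner (X := X) (Y := -Y) (T := Z p) (w₁ := -F.conn x₀ (F.e₁ x₀ : Tan x₀))
    (w₂ := F.conn x₀ (F.e₂ x₀ : Tan x₀)) (c := -c) cg dA dX dY.neg
    (by
      filter_upwards [hnear] with y hy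
      have h := (hsol _ hy.2).1.2.1
      rw [betaOne, covD_eq_chart (F.twist a) hy.1 (mβ _ hy.2) fun x => (F.e₁ x : Tan x),
        covD_eq_chart (F.twist a) hy.1 (mβ _ hy.2) fun x => (F.e₂ x : Tan x)] at h
      simp only [Pi.neg_apply, map_neg, Complex.ofReal_neg]
      linear_combination 2 * h)
    (by
      have h := (hsol _ hp2).2.2
      rwa [betaZero, covD_eq_chart (F.twist a) hp1 (mβ _ hp2) F.T] at h)
    (by
      rw [fderiv_neg]
      simp only [Pi.neg_apply, map_neg, neg_apply]
      refine Eq.trans ?_ ((congrArg Neg.neg hbr).trans ?_) <;> module)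
  have hda := extD_eq_chart a (fun x => (F.e₁ x : Tan x)) (fun x => (F.e₂ x : Tan x)) x₀
  have hdω := extD_eq_chart F.conn (fun x => (F.e₁ x : Tan x)) (fun x => (F.e₂ x : Tan x)) x₀
  have hmono := (hsol x₀ hx₀).1.2.2
  have hmax' : IsLocalMax (fun y => ‖f y‖ ^ 2 + ‖g y‖ ^ 2) p := by
    have := htend.eventually hmax
    simpa [IsLocalMax, IsMaxFilter, hf, hg, hpx] using this
  have cf2 : ContDiffAt ℝ 2 (fun y => ‖f y‖ ^ 2) p := cf.norm_sq ℝ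
  have cg2 : ContDiffAt ℝ 2 (fun y => ‖g y‖ ^ 2) p := cg.norm_sq ℝ
  have hd1 : fderiv ℝ (fun y => ‖f y‖ ^ 2) p + fderiv ℝ (fun y => ‖g y‖ ^ 2) p = 0 := by
    rw [← fderiv_fun_add (cf2.differentiableAt (by simp)) (cg2.differentiableAt (by simp))]
    exact hmax'.fderiv_eq_zero
  have hd2 : ∀ v, fderiv ℝ (fderiv ℝ (fun y => ‖f y‖ ^ 2)) p v v +
      fderiv ℝ (fderiv ℝ (fun y => ‖g y‖ ^ 2)) p v v ≤ 0 := by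
    intro v
    have h := fderiv_fderiv_nonpos_of_isLocalMax hmax' (cf2.add cg2) v
    have hev : fderiv ℝ (fun y => ‖f y‖ ^ 2 + ‖g y‖ ^ 2) =ᶠ[nhds p]
        fun y => fderiv ℝ (fun y => ‖f y‖ ^ 2) y + fderiv ℝ (fun y => ‖g y‖ ^ 2) y := by
      filter_upwards [(cf2.of_le (m := 1) (by norm_num)).eventually (by simp),
        (cg2.of_le (m := 1) (by norm_num)).eventually (by simp)] with y h1 h2
      exact fderiv_fun_add (h1.differentiableAt (by simp)) (h2.differentiableAt (by simp))
    rw [hev.fderiv_eq, fderiv_fun_add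
      ((cf2.fderiv_right (m := 1) (by norm_num)).differentiableAt (by simp))
      ((cg2.fderiv_right (m := 1) (by norm_num)).differentiableAt (by simp))] at h
    exact h
  rw [fderiv_neg] at bβ
  simp only [Pi.neg_apply, map_neg, neg_apply, neg_neg] at bβ
  -- The two sign changes cancel, so both Bochner inequalities involve the same first-order term,
  -- which `hd1` then eliminates from their sum.
  have hvec : fderiv ℝ X p (X p) + fderiv ℝ Y p (Y p) +
      F.conn x₀ (F.e₂ x₀ : Tan x₀) • X p - -F.conn x₀ (F.e₁ x₀ : Tan x₀) • -Y p =
      fderiv ℝ X p (X p) + fderiv ℝ Y p (Y p) +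
      F.conn x₀ (F.e₂ x₀ : Tan x₀) • X p - F.conn x₀ (F.e₁ x₀ : Tan x₀) • Y p := by module
  rw [hvec] at bβ
  have hd1' := congrArg (fun L => L (fderiv ℝ X p (X p) + fderiv ℝ Y p (Y p) +
      F.conn x₀ (F.e₂ x₀ : Tan x₀) • X p - F.conn x₀ (F.e₁ x₀ : Tan x₀) • Y p)) hd1
  simp only [add_apply, zero_apply] at hd1'
  have hdA : fderiv ℝ (chartForm (F.twist a) x₀) p =
      fderiv ℝ (chartForm F.conn x₀) p + fderiv ℝ (chartForm a x₀) p := by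
    rw [htw]; exact fderiv_add dω da
  rw [hdA] at bβ
  simp only [add_apply] at bβ
  have hfp : f p = α x₀ := congrArg α hpx
  have hgp : g p = F.comp β x₀ := congrArg (F.comp β) hpx
  rw [hfp] at bα
  rw [hgp] at bβ
  have hw : F.webster x₀ = -(1 / 2) * (fderiv ℝ (chartForm F.conn x₀) p (X p) (Y p) -
      fderiv ℝ (chartForm F.conn x₀) p (Y p) (X p)) := by rw [← hdω, webster]
  rw [hda] at hmono
  change fderiv ℝ (chartForm a x₀) p (X p) (Y p) - fderiv ℝ (chartForm a x₀) p (Y p) (X p) - _ = _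
    at hmono
  have hxx := hd2 (X p)
  have hyy := hd2 (Y p)
  generalize hA : ‖α x₀‖ ^ 2 = A at *
  generalize hB : ‖F.comp β x₀‖ ^ 2 = B at *
  have hA0 : 0 ≤ A := by rw [← hA]; positivity
  have hB0 : 0 ≤ B := by rw [← hB]; positivity
  -- Sum of the two inequalities: `da(e₁, e₂) = W + (A - B)` multiplies `A`, and `-(dω + da)(e₁, e₂)
  -- = W - (A - B)` multiplies `B`.
  have hfin : F.webster x₀ * (A + B) + (A - B) ^ 2 ≤ 0 := by
    have e1 : fderiv ℝ (chartForm a x₀) p (X p) (Y p) - fderiv ℝ (chartForm a x₀) p (Y p) (X p) =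
        F.webster x₀ + (A - B) := by linarith
    have e2 : fderiv ℝ (chartForm F.conn x₀) p (X p) (Y p) -
        fderiv ℝ (chartForm F.conn x₀) p (Y p) (X p) = -2 * F.webster x₀ := by linarith
    have m1 := congrArg (· * A) e1
    have m2 := congrArg (· * B) e1
    have m3 := congrArg (· * B) e2
    linarith
  have hsum : A + B ≤ 0 := by
    by_contra! h
    nlinarith [mul_pos hW h, sq_nonneg (A - B)]
  have hA1 : A = 0 := by linarith
  have hB1 : B = 0 := by linarith
  rw [hA1] at hA
  rw [hB1] at hB
  exact ⟨by simpa using hA, by simpa using hB⟩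

end UnitaryFrame

end Frames

end ContactMonopole

end

/-! ### Globalization by compactness -/

theorem theoremB (M : Type*) [TopologicalSpace M] [ChartedSpace ContactMonopole.E3 M]
    [IsManifold (𝓡 3) ∞ M] [CompactSpace M] [T2Space M]
    (ξ : ContactMonopole.OrientedContactStructure M)
    (P : ContactMonopole.OrientedPseudohermitian ξ)
    (hW : P.PositiveWebster) :
    ¬ ∃ (a : ContactMonopole.OneForm M) (α : M → ℂ) (β : ContactMonopole.ZeroOneForm P),
        P.IsReebParallelMonopole a α β ∧ ¬ P.IsTrivial α β := by
  rintro ⟨a, α, β, hsol, hnt⟩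
  apply hnt
  choose F hF hEq using hsol.equations
  -- The frame is chosen separately at each point, so `u` is not visibly continuous; frame
  -- independence identifies it near `x₀` with the expression in the single frame `F x₀`.
  let u : M → ℝ := fun x => ‖α x‖ ^ 2 + ‖(F x).comp β x‖ ^ 2
  have hu : ∀ x₀, ∀ x ∈ (F x₀).U, u x = ‖α x‖ ^ 2 + ‖(F x₀).comp β x‖ ^ 2 := fun x₀ x hx => by
    simp only [u]
    rw [(F x₀).norm_comp_eq (F x) β hx (hF x)]
  have hev : ∀ x₀, u =ᶠ[nhds x₀] fun x => ‖α x‖ ^ 2 + ‖(F x₀).comp β x‖ ^ 2 := fun x₀ =>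
    Filter.eventually_of_mem ((F x₀).isOpen.mem_nhds (hF x₀)) (hu x₀)
  have hcont : Continuous u := continuous_iff_continuousAt.2 fun x₀ => by
    refine ContinuousAt.congr ?_ (hev x₀).symm
    have h1 := hsol.α_smooth.continuous.continuousAt (x := x₀)
    have h2 := (((F x₀).comp_smooth β).contMDiffAt ((F x₀).isOpen.mem_nhds (hF x₀))).continuousAt
    exact (h1.norm.pow 2).add (h2.norm.pow 2)
  have hzero : ∀ x, u x ≤ 0 := by
    intro x
    obtain ⟨x₀, -, hx₀⟩ := isCompact_univ.exists_isMaxOn ⟨x, Set.mem_univ x⟩ hcont.continuousOn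
    have hmax : IsLocalMax u x₀ := hx₀.isLocalMax Filter.univ_mem
    obtain ⟨h1, h2⟩ := (F x₀).eq_zero_of_isLocalMax (hF x₀) hsol.a_smooth hsol.α_smooth
      (hEq x₀) (hW _ _ (hF x₀)) (hmax.congr (hev x₀))
    have h3 : u x ≤ u x₀ := hx₀ (Set.mem_univ x)
    simpa [u, h1, h2] using h3
  refine ⟨fun x => ?_, fun x => (F x).form_eq_zero_of_comp_eq_zero (hF x) ?_⟩
  · have h : ‖α x‖ ^ 2 ≤ 0 := (le_add_of_nonneg_right (by positivity)).trans (hzero x)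
    simpa using h.antisymm (by positivity)
  · have h : ‖(F x).comp β x‖ ^ 2 ≤ 0 := (le_add_of_nonneg_left (by positivity)).trans (hzero x)
    simpa using h.antisymm (by positivity)
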